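/- Let $\mathcal X$ be a real or complex Banach space with $\dim\mathcal X\ge 2$. Let $\mathcal N$ be a nest on $\mathcal X$, i.e. a chain of closed subspaces of $\mathcal X$ containing $\{0\}$ and $\mathcal X$ such that the intersection and the closed linear span of every family of members of $\mathcal N$ belong to $\mathcal N$. For $N\in\mathcal N$ let $N_-$ be the closed linear span of $\bigcup\{M\in\mathcal N : M\subsetneq N\}$, and assume that every $N\in\mathcal N$ with $N_-=N$ is complemented in $\mathcal X$. Let $\mathrm{Alg}\,\mathcal N$ be the algebra of all bounded linear operators on $\mathcal X$ that leave every member of $\mathcal N$ invariant. A linear map $\gamma$ on an algebra $\mathcal A$ is a generalized derivation if there is a linear map $\tau:\mathcal A\to\mathcal A$ with $\gamma(ab)=\gamma(a)b+a\tau(b)$ for all $a,b\in\mathcal A$. A linear map $\delta$ on $\mathcal A$ is a local generalized derivation if for every $a\in\mathcal A$ there is a generalized derivation $\delta_a:\mathcal A\to\mathcal A$ with $\delta(a)=\delta_a(a)$. Then for every linear map $\delta:\mathrm{Alg}\,\mathcal N\to\mathrm{Alg}\,\mathcal N$ (not assumed continuous) the following are equivalent: (i) $\delta$ is a generalized derivation;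 (ii) $\delta$ is a local generalized derivation; (iii) $A\delta(B)C=0$ for all $A,B,C\in\mathrm{Alg}\,\mathcal N$ with $AB=BC=0$. -/

import Mathlib

section NestAlgebras

variable {𝕜 X : Type*} [RCLike 𝕜] [NormedAddCommGroup X] [NormedSpace 𝕜 X]

/-- A nest on `X`: a chain of closed subspaces containing `{0}` and `X` and closed under arbitrary
intersections and closed linear spans. In the complete lattice `ClosedSubmodule 𝕜 X`, `sInf` is the
intersection and `sSup` is the closure of the linear span of the union. -/
structure IsNest (𝒩 : Set (ClosedSubmodule 𝕜 X)) : Prop where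
  chain : IsChain (· ≤ ·) 𝒩
  bot_mem : ⊥ ∈ 𝒩
  top_mem : ⊤ ∈ 𝒩
  sInf_mem : ∀ S : Set (ClosedSubmodule 𝕜 X), S ⊆ 𝒩 → sInf S ∈ 𝒩
  sSup_mem : ∀ S : Set (ClosedSubmodule 𝕜 X), S ⊆ 𝒩 → sSup S ∈ 𝒩

/-- `N₋`: the closed linear span of all members of `𝒩` properly contained in `N`. -/
noncomputable def nestPred (𝒩 : Set (ClosedSubmodule 𝕜 X)) (N : ClosedSubmodule 𝕜 X) :
    ClosedSubmodule 𝕜 X :=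
  sSup {M | M ∈ 𝒩 ∧ M < N}

/-- `Alg 𝒩`: the algebra of bounded operators on `X` leaving every member of `𝒩` invariant. -/
def nestAlgebra (𝒩 : Set (ClosedSubmodule 𝕜 X)) : Subalgebra 𝕜 (X →L[𝕜] X) where
  carrier := {A | ∀ N ∈ 𝒩, ∀ x ∈ N, A x ∈ N}
  mul_mem' := fun {A B} hA hB N hN x hx => hA N hN (B x) (hB N hN x hx)
  add_mem' := fun {_ _} hA hB N hN x hx =>
    N.toSubmodule.add_mem (hA N hN x hx) (hB N hN x hx)
  algebraMap_mem' := fun r N _ x hx => by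
    have h : (algebraMap 𝕜 (X →L[𝕜] X) r) x = r • x := by
      simp [Algebra.algebraMap_eq_smul_one]
    rw [h]
    exact N.toSubmodule.smul_mem r hx

end NestAlgebras

section Derivations

variable {R A : Type*} [CommRing R] [Ring A] [Algebra R A]

/-- `(γ, δ, τ)` is a ternary derivation: `γ(ab) = δ(a)b + aτ(b)` for all `a`, `b`. -/
def IsTernaryDerivation (γ δ τ : A →ₗ[R] A) : Prop :=
  ∀ a b : A, γ (a * b) = δ a * b + a * τ b

/-- `γ` is a generalized derivation: `(γ, γ, τ)` is a ternary derivation for some linear `τ`. -/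
def IsGeneralizedDerivation (γ : A →ₗ[R] A) : Prop :=
  ∃ τ : A →ₗ[R] A, IsTernaryDerivation γ γ τ

/-- `δ` agrees at each point with some generalized derivation depending on the point. -/
def IsLocalGeneralizedDerivation (δ : A →ₗ[R] A) : Prop :=
  ∀ a : A, ∃ δ' : A →ₗ[R] A, IsGeneralizedDerivation δ' ∧ δ a = δ' a

end Derivations

/- A linear map `δ` on an algebra is a generalized derivation iff all double commutators
`[[δ, Lₐ], R_c]` with left and right multiplications vanish. For fixed `c` the set of such `a` is a
subalgebra, and symmetrically in `c`; condition (iii) gives the vanishing when `a` and `c` are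
idempotents, hence on the subalgebra generated by the idempotents. The cocycle identities for the
double commutator then spread the vanishing to the whole algebra, provided that this subalgebra
contains an ideal without annihilators. In a nest algebra the rank-one operators `f ⊗ x`, with
`x ∈ N` and `f` vanishing on `N₋`, form such an ideal up to sums; only when `N₋ = N` does one need
a complement of `N` to write them through idempotents. -/

section FirstOrderDefect

variable {R A : Type*} [CommRing R] [Ring A] [Algebra R A]

/-- The value at `b` of the double commutator `[[δ, Lₐ], R_c]`, where `Lₐ` and `R_c` are left and
right multiplication. It vanishes identically iff `δ` is a first-order operator on the bimodule `A`,
that is, a generalized derivation. -/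
def firstOrderDefect (δ : A →ₗ[R] A) (a b c : A) : A :=
  δ (a * b * c) - a * δ (b * c) - δ (a * b) * c + a * δ b * c

theorem isGeneralizedDerivation_iff_firstOrderDefect {δ : A →ₗ[R] A} :
    IsGeneralizedDerivation δ ↔ ∀ a b c, firstOrderDefect δ a b c = 0 := by
  constructor
  · rintro ⟨τ, hτ⟩ a b c
    rw [firstOrderDefect, hτ (a * b) c, hτ b c]
    noncomm_ring
  · refine fun h => ⟨δ - LinearMap.mulLeft R (δ 1), fun a b => ?_⟩
    have hab := h a 1 b
    simp only [firstOrderDefect, mul_one, one_mul] at hab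
    rw [← sub_eq_zero, ← hab, LinearMap.sub_apply, LinearMap.mulLeft_apply]
    noncomm_ring

variable (δ : A →ₗ[R] A)

theorem firstOrderDefect_mul_left (s a b c : A) :
    firstOrderDefect δ (s * a) b c =
      firstOrderDefect δ s (a * b) c + s * firstOrderDefect δ a b c := by
  simp only [firstOrderDefect]
  noncomm_ring

theorem firstOrderDefect_mul_right (a b c t : A) :
    firstOrderDefect δ a b (c * t) =
      firstOrderDefect δ a (b * c) t + firstOrderDefect δ a b c * t := by
  simp only [firstOrderDefect]
  noncomm_ring

theorem firstOrderDefect_add_left (a a' b c : A) :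
    firstOrderDefect δ (a + a') b c = firstOrderDefect δ a b c + firstOrderDefect δ a' b c := by
  simp only [firstOrderDefect, add_mul, map_add]
  abel

theorem firstOrderDefect_add_right (a b c c' : A) :
    firstOrderDefect δ a b (c + c') = firstOrderDefect δ a b c + firstOrderDefect δ a b c' := by
  simp only [firstOrderDefect, mul_add, map_add]
  abel

theorem firstOrderDefect_algebraMap_left (r : R) (b c : A) :
    firstOrderDefect δ (algebraMap R A r) b c = 0 := by
  simp [firstOrderDefect, Algebra.algebraMap_eq_smul_one]

theorem firstOrderDefect_algebraMap_right (a b : A) (r : R) :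
    firstOrderDefect δ a b (algebraMap R A r) = 0 := by
  simp [firstOrderDefect, Algebra.algebraMap_eq_smul_one]

variable {δ}

theorem firstOrderDefect_eq_zero_of_mem_adjoin_left {S : Set A} {a c : A}
    (hS : ∀ s ∈ S, ∀ b, firstOrderDefect δ s b c = 0) (ha : a ∈ Algebra.adjoin R S) (b : A) :
    firstOrderDefect δ a b c = 0 := by
  induction ha using Algebra.adjoin_induction generalizing b with
  | mem s hs => exact hS s hs b
  | algebraMap r => exact firstOrderDefect_algebraMap_left δ r b c
  | add x y _ _ hx hy => rw [firstOrderDefect_add_left, hx, hy, add_zero]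
  | mul x y _ _ hx hy => rw [firstOrderDefect_mul_left, hx, hy, mul_zero, add_zero]

theorem firstOrderDefect_eq_zero_of_mem_adjoin_right {S : Set A} {a c : A}
    (hS : ∀ s ∈ S, ∀ b, firstOrderDefect δ a b s = 0) (hc : c ∈ Algebra.adjoin R S) (b : A) :
    firstOrderDefect δ a b c = 0 := by
  induction hc using Algebra.adjoin_induction generalizing b with
  | mem s hs => exact hS s hs b
  | algebraMap r => exact firstOrderDefect_algebraMap_right δ a b r
  | add x y _ _ hx hy => rw [firstOrderDefect_add_right, hx, hy, add_zero]
  | mul x y _ _ hx hy => rw [firstOrderDefect_mul_right, hx, hy, zero_mul, add_zero]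

theorem firstOrderDefect_eq_zero_of_faithful_left {I : Set A} {c : A}
    (hI : ∀ s ∈ I, ∀ b, firstOrderDefect δ s b c = 0) (hI_mul : ∀ s ∈ I, ∀ a, s * a ∈ I)
    (hI_faithful : ∀ x, (∀ s ∈ I, s * x = 0) → x = 0) (a b : A) :
    firstOrderDefect δ a b c = 0 :=
  hI_faithful _ fun s hs => by
    simpa only [hI _ (hI_mul s hs a), hI s hs, zero_add, eq_comm] using
      firstOrderDefect_mul_left δ s a b c

theorem firstOrderDefect_eq_zero_of_faithful_right {I : Set A} {a : A}
    (hI : ∀ t ∈ I, ∀ b, firstOrderDefect δ a b t = 0) (hI_mul : ∀ t ∈ I, ∀ c, c * t ∈ I)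
    (hI_faithful : ∀ x, (∀ t ∈ I, x * t = 0) → x = 0) (b c : A) :
    firstOrderDefect δ a b c = 0 :=
  hI_faithful _ fun t ht => by
    simpa only [hI _ (hI_mul t ht c), hI t ht, zero_add, eq_comm] using
      firstOrderDefect_mul_right δ a b c t

end FirstOrderDefect

section ZeroProducts

variable {R A : Type*} [CommRing R] [Ring A] [Algebra R A] {δ : A →ₗ[R] A}

theorem IsGeneralizedDerivation.isLocalGeneralizedDerivation (hδ : IsGeneralizedDerivation δ) :
    IsLocalGeneralizedDerivation δ :=
  fun _ => ⟨δ, hδ, rfl⟩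

theorem IsLocalGeneralizedDerivation.mul_apply_mul_eq_zero
    (hδ : IsLocalGeneralizedDerivation δ) {a b c : A} (hab : a * b = 0) (hbc : b * c = 0) :
    a * δ b * c = 0 := by
  obtain ⟨γ, hγ, hδγ⟩ := hδ b
  have hdefect := isGeneralizedDerivation_iff_firstOrderDefect.1 hγ a b c
  simpa [firstOrderDefect, hab, hbc, hδγ] using hdefect

theorem apply_mul_mul_one_sub_of_isIdempotentElem
    (hδ : ∀ a b c : A, a * b = 0 → b * c = 0 → a * δ b * c = 0)
    {p q : A} (hp : IsIdempotentElem p) (hq : IsIdempotentElem q) (b : A) :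
    δ (p * b * q) * (1 - q) = p * δ (b * q) * (1 - q) := by
  have hright (x : A) : x * q * (1 - q) = 0 := by rw [mul_assoc, hq.mul_one_sub_self, mul_zero]
  have h₁ : (1 - p) * δ (p * b * q) * (1 - q) = 0 :=
    hδ _ _ _ (by simp only [← mul_assoc, hp.one_sub_mul_self, zero_mul]) (hright _)
  have h₂ : p * δ ((1 - p) * b * q) * (1 - q) = 0 :=
    hδ _ _ _ (by simp only [← mul_assoc, hp.mul_one_sub_self, zero_mul]) (hright _)
  calc δ (p * b * q) * (1 - q) = p * δ (p * b * q) * (1 - q) := by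
        rwa [sub_mul 1 p, one_mul, sub_mul, sub_eq_zero] at h₁
    _ = p * δ (b * q) * (1 - q) := by
        rw [sub_mul 1 p, one_mul, sub_mul b, map_sub, mul_sub p, sub_mul, sub_eq_zero] at h₂
        exact h₂.symm

theorem firstOrderDefect_eq_zero_of_isIdempotentElem
    (hδ : ∀ a b c : A, a * b = 0 → b * c = 0 → a * δ b * c = 0)
    {p q : A} (hp : IsIdempotentElem p) (hq : IsIdempotentElem q) (b : A) :
    firstOrderDefect δ p b q = 0 := by
  have h₁ := apply_mul_mul_one_sub_of_isIdempotentElem hδ hp hq b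
  have h₂ := apply_mul_mul_one_sub_of_isIdempotentElem hδ hp hq.one_sub b
  rw [← sub_eq_zero] at h₁ h₂
  calc firstOrderDefect δ p b q
      = (δ (p * b * q) * (1 - q) - p * δ (b * q) * (1 - q)) -
        (δ (p * b * (1 - q)) * (1 - (1 - q)) - p * δ (b * (1 - q)) * (1 - (1 - q))) := by
        simp only [firstOrderDefect, mul_sub, sub_mul, mul_one, map_sub, sub_sub_cancel]
        abel
    _ = 0 := by rw [h₁, h₂, sub_zero]

/-- The subalgebra generated by the idempotents of `A`. Condition (iii) controls
`firstOrderDefect δ a b c` for `a` and `c` in it. -/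
abbrev idempotentSubalgebra (R A : Type*) [CommRing R] [Ring A] [Algebra R A] : Subalgebra R A :=
  Algebra.adjoin R {p : A | IsIdempotentElem p}

theorem mem_idempotentSubalgebra_of_isIdempotentElem {p : A} (hp : IsIdempotentElem p) :
    p ∈ idempotentSubalgebra R A :=
  Algebra.subset_adjoin hp

theorem firstOrderDefect_eq_zero_of_mem_idempotentSubalgebra
    (hδ : ∀ a b c : A, a * b = 0 → b * c = 0 → a * δ b * c = 0) {s t : A}
    (hs : s ∈ idempotentSubalgebra R A) (ht : t ∈ idempotentSubalgebra R A) (b : A) :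
    firstOrderDefect δ s b t = 0 :=
  firstOrderDefect_eq_zero_of_mem_adjoin_left (fun _ hp =>
    firstOrderDefect_eq_zero_of_mem_adjoin_right (fun _ hq =>
      firstOrderDefect_eq_zero_of_isIdempotentElem hδ hp hq) ht) hs b

theorem isGeneralizedDerivation_of_faithful_ideal {I : Set A}
    (hI : I ⊆ idempotentSubalgebra R A)
    (hI_right : ∀ s ∈ I, ∀ a, s * a ∈ I) (hI_left : ∀ s ∈ I, ∀ a, a * s ∈ I)
    (hI_faithful_left : ∀ x, (∀ s ∈ I, s * x = 0) → x = 0)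
    (hI_faithful_right : ∀ x, (∀ s ∈ I, x * s = 0) → x = 0)
    (hδ : ∀ a b c : A, a * b = 0 → b * c = 0 → a * δ b * c = 0) :
    IsGeneralizedDerivation δ := by
  rw [isGeneralizedDerivation_iff_firstOrderDefect]
  have hδI : ∀ t ∈ I, ∀ a b, firstOrderDefect δ a b t = 0 := fun t ht =>
    firstOrderDefect_eq_zero_of_faithful_left
      (fun s hs => firstOrderDefect_eq_zero_of_mem_idempotentSubalgebra hδ (hI hs) (hI ht))
      hI_right hI_faithful_left
  exact fun a =>
    firstOrderDefect_eq_zero_of_faithful_right (fun t ht => hδI t ht a) hI_left hI_faithful_right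

theorem mem_idempotentSubalgebra_of_mul_add_mul_eq {q t : A} {r : R} (hq : IsIdempotentElem q)
    (hqt : q * t + t * q = t + r • q) (htt : t * t = r • t) : t ∈ idempotentSubalgebra R A := by
  have he : IsIdempotentElem ((1 - r) • q + t) := by
    calc ((1 - r) • q + t) * ((1 - r) • q + t)
        = ((1 - r) * (1 - r)) • (q * q) + (1 - r) • (q * t + t * q) + t * t := by
          simp only [add_mul, mul_add, smul_mul_assoc, mul_smul_comm, smul_add, mul_smul]
          abel
      _ = (1 - r) • q + t := by
          rw [hq.eq, hqt, htt]
          module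
  rw [← add_sub_cancel_left ((1 - r) • q) t]
  exact sub_mem (mem_idempotentSubalgebra_of_isIdempotentElem he)
    (Subalgebra.smul_mem _ (mem_idempotentSubalgebra_of_isIdempotentElem hq) _)

end ZeroProducts

theorem exists_strongDual_eq_zero_on_and_eq_one {𝕜 X : Type*} [RCLike 𝕜] [NormedAddCommGroup X]
    [NormedSpace 𝕜 X] (N : ClosedSubmodule 𝕜 X) {y : X} (hy : y ∉ N) :
    ∃ f : StrongDual 𝕜 X, (∀ z ∈ N, f z = 0) ∧ f y = 1 := by
  have : IsClosed (N.toSubmodule : Set X) := N.isClosed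
  have hy : N.toSubmodule.mkQ y ≠ 0 := by simpa using hy
  obtain ⟨g, hg⟩ := SeparatingDual.exists_eq_one (R := 𝕜) hy
  refine ⟨g.comp N.toSubmodule.mkQL, fun z hz => ?_, by simpa using hg⟩
  have hz : N.toSubmodule.mkQ z = 0 := by simpa using hz
  simpa using congrArg g hz

section Nests

variable {𝕜 X : Type*} [RCLike 𝕜] [NormedAddCommGroup X] [NormedSpace 𝕜 X]
  {𝒩 : Set (ClosedSubmodule 𝕜 X)} {M N : ClosedSubmodule 𝕜 X}

theorem nestPred_le (𝒩 : Set (ClosedSubmodule 𝕜 X)) (N : ClosedSubmodule 𝕜 X) :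
    nestPred 𝒩 N ≤ N :=
  sSup_le fun _ hM => hM.2.le

namespace IsNest

theorem nestPred_mem (h𝒩 : IsNest 𝒩) (N : ClosedSubmodule 𝕜 X) : nestPred 𝒩 N ∈ 𝒩 :=
  h𝒩.sSup_mem _ fun _ hM => hM.1

theorem le_nestPred_or_le (h𝒩 : IsNest 𝒩) (hM : M ∈ 𝒩) (hN : N ∈ 𝒩) :
    M ≤ nestPred 𝒩 N ∨ N ≤ M := by
  by_cases hNM : N ≤ M
  · exact .inr hNM
  · exact .inl (le_sSup ⟨hM, ((h𝒩.chain.total hM hN).resolve_right hNM).lt_of_not_ge hNM⟩)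

theorem exists_notMem_nestPred (h𝒩 : IsNest 𝒩) {y : X} (hy : y ≠ 0) :
    ∃ N ∈ 𝒩, N ≠ ⊥ ∧ y ∉ nestPred 𝒩 N := by
  set M := sInf {N | N ∈ 𝒩 ∧ N ≠ ⊥} with hM
  by_cases hyM : y ∈ M
  · have hM_pred : nestPred 𝒩 M = ⊥ := by
      refine le_bot_iff.1 (sSup_le fun N ⟨hN, hNM⟩ => ?_)
      by_contra hN_bot
      exact hNM.not_ge (sInf_le ⟨hN, mt le_of_eq hN_bot⟩)
    refine ⟨M, h𝒩.sInf_mem _ fun _ hN => hN.1, fun hM_bot => hy ?_, fun hy_pred => hy ?_⟩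
    · simpa [hM_bot] using hyM
    · simpa [hM_pred] using hy_pred
  · obtain ⟨N, ⟨hN, hN_bot⟩, hyN⟩ : ∃ N ∈ {N | N ∈ 𝒩 ∧ N ≠ ⊥}, y ∉ N := by
      simpa [hM, and_assoc] using hyM
    exact ⟨N, hN, hN_bot, fun h => hyN (nestPred_le 𝒩 N h)⟩

theorem sSup_nestPred_ne_top (h𝒩 : IsNest 𝒩) : sSup {N | N ∈ 𝒩 ∧ nestPred 𝒩 N ≠ ⊤} = ⊤ := by
  by_cases htop : nestPred 𝒩 ⊤ = ⊤
  · refine top_unique (htop.ge.trans (sSup_le_sSup fun N hN => ?_))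
    exact ⟨hN.1, ((nestPred_le 𝒩 N).trans_lt hN.2).ne⟩
  · exact top_unique (le_sSup ⟨h𝒩.top_mem, htop⟩)

theorem smulRight_mem (h𝒩 : IsNest 𝒩) (hN : N ∈ 𝒩) {x : X} (hx : x ∈ N) {f : StrongDual 𝕜 X}
    (hf : ∀ z ∈ nestPred 𝒩 N, f z = 0) : f.smulRight x ∈ nestAlgebra 𝒩 := by
  intro M hM z hz
  rw [ContinuousLinearMap.smulRight_apply]
  rcases h𝒩.le_nestPred_or_le hM hN with hMN | hNM
  · rw [hf z (hMN hz), zero_smul]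
    exact zero_mem M
  · exact SMulMemClass.smul_mem _ (hNM hx)

theorem subtypeL_comp_mem (h𝒩 : IsNest 𝒩) (hN : N ∈ 𝒩) {π : X →L[𝕜] N.toSubmodule}
    (hπ : ∀ z : N.toSubmodule, π z = z) : N.toSubmodule.subtypeL.comp π ∈ nestAlgebra 𝒩 := by
  intro M hM z hz
  rcases h𝒩.chain.total hM hN with hMN | hNM
  · simpa [hπ ⟨z, hMN hz⟩] using hz
  · exact hNM (π z).2

end IsNest

/-- The rank-one operators `f ⊗ x` with `x ∈ N` and `f` vanishing on `N₋` for some `N ∈ 𝒩`, written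
`f.smulRight x`. The zero operator is included, so that the set absorbs multiplication. -/
def nestRankOne (𝒩 : Set (ClosedSubmodule 𝕜 X)) : Set (nestAlgebra 𝒩) :=
  {T | ∃ N ∈ 𝒩, ∃ x ∈ N, ∃ f : StrongDual 𝕜 X, (∀ z ∈ nestPred 𝒩 N, f z = 0) ∧
    (T : X →L[𝕜] X) = f.smulRight x}

theorem mul_mem_nestRankOne {T : nestAlgebra 𝒩} (hT : T ∈ nestRankOne 𝒩) (A : nestAlgebra 𝒩) :
    A * T ∈ nestRankOne 𝒩 := by
  obtain ⟨N, hN, x, hx, f, hf, hT⟩ := hT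
  refine ⟨N, hN, (A : X →L[𝕜] X) x, A.2 N hN x hx, f, hf, ?_⟩
  ext z
  simp [hT]

namespace IsNest

theorem nestRankOne_mul_mem (h𝒩 : IsNest 𝒩) {T : nestAlgebra 𝒩} (hT : T ∈ nestRankOne 𝒩)
    (A : nestAlgebra 𝒩) : T * A ∈ nestRankOne 𝒩 := by
  obtain ⟨N, hN, x, hx, f, hf, hT⟩ := hT
  refine ⟨N, hN, x, hx, f.comp (A : X →L[𝕜] X),
    fun z hz => hf _ (A.2 _ (h𝒩.nestPred_mem N) z hz), ?_⟩
  ext z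
  simp [hT]

theorem eq_zero_of_forall_nestRankOne_mul (h𝒩 : IsNest 𝒩) (A : nestAlgebra 𝒩)
    (hA : ∀ T ∈ nestRankOne 𝒩, T * A = 0) : A = 0 := by
  ext z
  by_contra hAz
  obtain ⟨N, hN, hN_bot, hAzN⟩ := h𝒩.exists_notMem_nestPred hAz
  obtain ⟨x, hxN, hx⟩ := SetLike.exists_of_lt (bot_lt_iff_ne_bot.2 hN_bot)
  obtain ⟨f, hf, hfAz⟩ := exists_strongDual_eq_zero_on_and_eq_one _ hAzN
  have hTA := hA ⟨_, h𝒩.smulRight_mem hN hxN hf⟩ ⟨N, hN, x, hxN, f, hf, rfl⟩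
  have hTAz := congrArg (fun S : nestAlgebra 𝒩 => (S : X →L[𝕜] X) z) hTA
  exact hx (by simpa [hfAz] using hTAz)

theorem eq_zero_of_forall_mul_nestRankOne (h𝒩 : IsNest 𝒩) (A : nestAlgebra 𝒩)
    (hA : ∀ T ∈ nestRankOne 𝒩, A * T = 0) : A = 0 := by
  suffices hker : ⊤ ≤ (⊥ : ClosedSubmodule 𝕜 X).comap (A : X →L[𝕜] X) by
    ext z
    exact hker ClosedSubmodule.mem_top
  rw [← h𝒩.sSup_nestPred_ne_top]
  refine sSup_le fun N ⟨hN, hN_top⟩ x hx => ?_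
  obtain ⟨y, -, hy⟩ := SetLike.exists_of_lt (lt_top_iff_ne_top.2 hN_top)
  obtain ⟨f, hf, hfy⟩ := exists_strongDual_eq_zero_on_and_eq_one _ hy
  have hAT := hA ⟨_, h𝒩.smulRight_mem hN hx hf⟩ ⟨N, hN, x, hx, f, hf, rfl⟩
  have hATy := congrArg (fun S : nestAlgebra 𝒩 => (S : X →L[𝕜] X) y) hAT
  simpa [hfy] using hATy

theorem mem_idempotentSubalgebra_of_closedComplemented (h𝒩 : IsNest 𝒩) (hN : N ∈ 𝒩)
    (hcompl : N.toSubmodule.ClosedComplemented) {T : nestAlgebra 𝒩} {x : X} (hx : x ∈ N)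
    {f : StrongDual 𝕜 X} (hf : ∀ z ∈ N, f z = 0) (hT : (T : X →L[𝕜] X) = f.smulRight x) :
    T ∈ idempotentSubalgebra 𝕜 (nestAlgebra 𝒩) := by
  obtain ⟨π, hπ⟩ := hcompl
  let P : nestAlgebra 𝒩 := ⟨_, h𝒩.subtypeL_comp_mem hN hπ⟩
  have hP : IsIdempotentElem P := by
    ext z
    simp [P, hπ]
  have hPT : P * T + T * P = T + (0 : 𝕜) • P := by
    ext z
    simp [P, hT, hπ ⟨x, hx⟩, hf _ (π z).2]
  have hTT : T * T = (0 : 𝕜) • T := by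
    ext z
    simp [hT, hf x hx]
  exact mem_idempotentSubalgebra_of_mul_add_mul_eq hP hPT hTT

theorem mem_idempotentSubalgebra_of_nestPred_lt (h𝒩 : IsNest 𝒩) (hN : N ∈ 𝒩)
    (hpred : nestPred 𝒩 N < N) {T : nestAlgebra 𝒩} {x : X} (hx : x ∈ N)
    {f : StrongDual 𝕜 X} (hf : ∀ z ∈ nestPred 𝒩 N, f z = 0)
    (hT : (T : X →L[𝕜] X) = f.smulRight x) :
    T ∈ idempotentSubalgebra 𝕜 (nestAlgebra 𝒩) := by
  obtain ⟨y, hyN, hy⟩ := SetLike.exists_of_lt hpred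
  obtain ⟨g, hg, hgy⟩ := exists_strongDual_eq_zero_on_and_eq_one _ hy
  -- Each factor of `f ⊗ x = (g ⊗ x) (f ⊗ y)` shares a leg with the idempotent `g ⊗ y`.
  let Q : nestAlgebra 𝒩 := ⟨g.smulRight y, h𝒩.smulRight_mem hN hyN hg⟩
  let U : nestAlgebra 𝒩 := ⟨g.smulRight x, h𝒩.smulRight_mem hN hx hg⟩
  let V : nestAlgebra 𝒩 := ⟨f.smulRight y, h𝒩.smulRight_mem hN hyN hf⟩
  have hTUV : T = U * V := by
    ext z
    simp [U, V, hT, hgy]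
  have hQ : IsIdempotentElem Q := by
    ext z
    simp [Q, hgy]
  have hU : U ∈ idempotentSubalgebra 𝕜 (nestAlgebra 𝒩) := by
    refine mem_idempotentSubalgebra_of_mul_add_mul_eq (r := g x) hQ ?_ ?_ <;> ext z
    · simp [U, Q, hgy, smul_smul, mul_comm, add_comm]
    · simp [U, smul_smul, mul_comm]
  have hV : V ∈ idempotentSubalgebra 𝕜 (nestAlgebra 𝒩) := by
    refine mem_idempotentSubalgebra_of_mul_add_mul_eq (r := f y) hQ ?_ ?_ <;> ext z
    · simp [V, Q, hgy, smul_smul, mul_comm]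
    · simp [V, smul_smul, mul_comm]
  exact hTUV ▸ mul_mem hU hV

theorem nestRankOne_subset_idempotentSubalgebra (h𝒩 : IsNest 𝒩)
    (hcompl : ∀ N ∈ 𝒩, nestPred 𝒩 N = N → N.toSubmodule.ClosedComplemented) :
    nestRankOne 𝒩 ⊆ idempotentSubalgebra 𝕜 (nestAlgebra 𝒩) := by
  rintro T ⟨N, hN, x, hx, f, hf, hT⟩
  rcases (nestPred_le 𝒩 N).eq_or_lt with hpred | hpred
  · rw [hpred] at hf
    exact h𝒩.mem_idempotentSubalgebra_of_closedComplemented hN (hcompl N hN hpred) hx hf hT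
  · exact h𝒩.mem_idempotentSubalgebra_of_nestPred_lt hN hpred hx hf hT

end IsNest

end Nests

theorem corollary3p6_general {𝕜 X : Type*} [RCLike 𝕜] [NormedAddCommGroup X] [NormedSpace 𝕜 X]
    (𝒩 : Set (ClosedSubmodule 𝕜 X)) (h𝒩 : IsNest 𝒩)
    (hcompl : ∀ N ∈ 𝒩, nestPred 𝒩 N = N → N.toSubmodule.ClosedComplemented)
    (δ : nestAlgebra 𝒩 →ₗ[𝕜] nestAlgebra 𝒩) :
    List.TFAE [
      IsGeneralizedDerivation δ,
      IsLocalGeneralizedDerivation δ,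
      ∀ A B C : nestAlgebra 𝒩, A * B = 0 → B * C = 0 → A * δ B * C = 0] := by
  tfae_have 1 → 2 := IsGeneralizedDerivation.isLocalGeneralizedDerivation
  tfae_have 2 → 3 := fun hδ _ _ _ => hδ.mul_apply_mul_eq_zero
  tfae_have 3 → 1 := isGeneralizedDerivation_of_faithful_ideal
    (h𝒩.nestRankOne_subset_idempotentSubalgebra hcompl)
    (fun _ => h𝒩.nestRankOne_mul_mem) (fun _ => mul_mem_nestRankOne)
    h𝒩.eq_zero_of_forall_nestRankOne_mul h𝒩.eq_zero_of_forall_mul_nestRankOne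
  tfae_finish

theorem corollary3p6 {𝕜 X : Type*} [RCLike 𝕜] [NormedAddCommGroup X] [NormedSpace 𝕜 X]
    [CompleteSpace X] (hdim : 2 ≤ Module.rank 𝕜 X)
    (𝒩 : Set (ClosedSubmodule 𝕜 X)) (h𝒩 : IsNest 𝒩)
    (hcompl : ∀ N ∈ 𝒩, nestPred 𝒩 N = N → N.toSubmodule.ClosedComplemented)
    (δ : nestAlgebra 𝒩 →ₗ[𝕜] nestAlgebra 𝒩) :
    List.TFAE [
      IsGeneralizedDerivation δ,
      IsLocalGeneralizedDerivation δ,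
      ∀ A B C : nestAlgebra 𝒩, A * B = 0 → B * C = 0 → A * δ B * C = 0] :=
  corollary3p6_general 𝒩 h𝒩 hcompl δ
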